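/- Let $n$ be a power of $2$, let $k\ge 2$ be an integer and let $\alpha>0$ be real. Let $\Phi$ be the random $k\times n$ matrix whose $k$ rows are drawn independently and uniformly at random (with replacement) from the $n$ rows of the unnormalized $n\times n$ Hadamard matrix $\Psi_{\omega,t}=(-1)^{\langle\omega,t\rangle}$, where $\omega,t$ range over the vectors of length $\log_2 n$ over the binary field and $\langle\cdot,\cdot\rangle$ is the dot product over that field. For $y\in\mathbb R^n$ let $D_y$ be the diagonal matrix with diagonal $y$, let $B_2=\{y\in\mathbb R^n:\|y\|_2\le 1\}$ and $\alpha B_\infty=\{y\in\mathbb R^n:\|y\|_\infty\le\alpha\}$, let $\|\cdot\|$ denote the spectral norm of a matrix, and put $$E_\alpha=\mathbb E_\Phi\Bigl[\,\sup_{y\in B_2\cap\alpha B_\infty}\bigl\|D_y^2-\tfrac1k D_y\Phi^t\Phi D_y\bigr\|\,\Bigr].$$ Then there is a universal constant $C_1>0$ (independent of $n$, $k$, $\alpha$) such that $$E_\alpha\le\frac{C_1\log^{3/2}(n)\,\log^{1/2}(k)}{\sqrt k}\,(E_\alpha+\alpha^2)^{1/2}.$$ In particular, if $\frac{\log^{3/2}(n)\log^{1/2}(k)}{\sqrt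 k}=O(\alpha)$, then $E_\alpha=O\Bigl(\frac{\alpha\log^{3/2}(n)\log^{1/2}(k)}{\sqrt k}\Bigr)$; that is, for every $K>0$ there is a $C>0$ depending only on $K$ such that, for all such $n,k,\alpha$, the inequality $\frac{\log^{3/2}(n)\log^{1/2}(k)}{\sqrt k}\le K\alpha$ implies $E_\alpha\le C\,\frac{\alpha\log^{3/2}(n)\log^{1/2}(k)}{\sqrt k}$. -/

import Mathlib

open scoped Matrix BigOperators ENNReal

noncomputable section

namespace RandomHadamard

/-- The unnormalized Hadamard matrix of order `n = 2 ^ d`, with entries `(-1) ^ ⟨ω, t⟩`. Rows and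
columns are indexed by the `n` vectors of length `d` over the binary field, and `⟨ω, t⟩` is the dot
product over the binary field. -/
def hadamard (d : ℕ) : Matrix (Fin d → ZMod 2) (Fin d → ZMod 2) ℝ :=
  Matrix.of fun ω t => (-1 : ℝ) ^ (ω ⬝ᵥ t).val

/-- The `k × n` matrix `Φ` whose `i`-th row is the row of index `ω i` of the Hadamard matrix. -/
def rowMatrix {d k : ℕ} (ω : Fin k → (Fin d → ZMod 2)) : Matrix (Fin k) (Fin d → ZMod 2) ℝ :=
  (hadamard d).submatrix ω id

/-- The spectral norm of a real square matrix: the operator norm of the matrix acting on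
Euclidean space. -/
def specNorm {ι : Type} [Fintype ι] [DecidableEq ι] (M : Matrix ι ι ℝ) : ℝ :=
  ‖Matrix.toEuclideanCLM (n := ι) (𝕜 := ℝ) M‖

/-- `r B_p`: the vectors `y` with `‖y‖_p ≤ r`. -/
def lpBall (ι : Type) [Fintype ι] (p : ℝ≥0∞) (r : ℝ) : Set (ι → ℝ) :=
  {y | ‖(WithLp.toLp p y : PiLp p fun _ : ι => ℝ)‖ ≤ r}

/-- The deviation matrix `D_y ^ 2 - (1 / k) D_y Φᵗ Φ D_y`. -/
def deviation {ι : Type} [Fintype ι] [DecidableEq ι] {k : ℕ} (Φ : Matrix (Fin k) ι ℝ)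
    (y : ι → ℝ) : Matrix ι ι ℝ :=
  Matrix.diagonal y ^ 2 - (1 / (k : ℝ)) • (Matrix.diagonal y * Φᵀ * Φ * Matrix.diagonal y)

/-- The supremum of the spectral norm of the deviation matrix over `y ∈ B_2 ∩ α B_∞`. -/
def supDeviation {ι : Type} [Fintype ι] [DecidableEq ι] {k : ℕ} (Φ : Matrix (Fin k) ι ℝ)
    (α : ℝ) : ℝ :=
  sSup ((fun y : ι → ℝ => specNorm (deviation Φ y)) '' (lpBall ι 2 1 ∩ lpBall ι ∞ α))

/-- The set whose supremum is taken is bounded above, so that the real supremum is a genuine one. -/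
theorem bddAbove_deviation {ι : Type} [Fintype ι] [DecidableEq ι] {k : ℕ}
    (Φ : Matrix (Fin k) ι ℝ) (α : ℝ) :
    BddAbove ((fun y : ι → ℝ => specNorm (deviation Φ y)) ''
      (lpBall ι 2 1 ∩ lpBall ι ∞ α)) := by
  have hc : Continuous fun y : ι → ℝ => specNorm (deviation Φ y) := by
    have h1 : Continuous (Matrix.toEuclideanCLM (n := ι) (𝕜 := ℝ)) :=
      LinearMap.continuous_of_finiteDimensional
        (Matrix.toEuclideanCLM (n := ι) (𝕜 := ℝ)).toAlgEquiv.toLinearMap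
    have h2 : Continuous fun y : ι → ℝ => deviation Φ y := by
      unfold deviation
      fun_prop
    exact (h1.comp h2).norm
  refine BddAbove.mono (Set.image_mono ?_)
    ((isCompact_closedBall (0 : ι → ℝ) 1).image hc).bddAbove
  rintro y ⟨hy, -⟩
  rw [mem_closedBall_zero_iff]
  refine (pi_norm_le_iff_of_nonneg zero_le_one).2 fun i => ?_
  exact (PiLp.norm_apply_le (WithLp.toLp 2 y : PiLp 2 fun _ : ι => ℝ) i).trans hy

/-- The set whose supremum is taken is nonempty when `α ≥ 0`. -/
theorem nonempty_deviation {ι : Type} [Fintype ι] [DecidableEq ι] {k : ℕ}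
    (Φ : Matrix (Fin k) ι ℝ) {α : ℝ} (hα : 0 ≤ α) :
    ((fun y : ι → ℝ => specNorm (deviation Φ y)) ''
      (lpBall ι 2 1 ∩ lpBall ι ∞ α)).Nonempty :=
  Set.Nonempty.image _ ⟨0, by simp [lpBall], by simpa [lpBall] using hα⟩

/-- `E_α`, for `n = 2 ^ d`: the expectation of the supremum when the `k` rows of `Φ` are drawn
independently and uniformly from the `n` rows of the Hadamard matrix, that is, the average over all
`n ^ k` equally likely choices of the `k` row indices. -/
def expDeviation (d k : ℕ) (α : ℝ) : ℝ :=
  𝔼 ω : Fin k → (Fin d → ZMod 2), supDeviation (rowMatrix ω) α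

end RandomHadamard

end

/-! The deviation matrix is symmetric, so its spectral norm is governed by the form `quadDeviation`
at x = y * z with y in B_2 ∩ αB_∞ and ‖z‖_2 ≤ 1. Such x satisfy ‖x‖_1 ≤ 1 and ‖x‖_2 ≤ α. By
orthogonality of the Hadamard columns, ⟨row, x⟩² has mean ‖x‖_2² over a uniform row, so E_α measures
the uniform deviation of an empirical mean. Symmetrization (`sum_weight_norm_sub_le`) bounds k E_α
by twice the expected supremum over x of |∑ ±⟨Φ_i, x⟩²|.

With Φ fixed, this Rademacher process is chained in `expect_norm_sum_sgn_sq_le`. By Maurey's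
argument (`exists_empirical_approx`), averages of 4^j signed columns approximate every Φx in sup
norm to within O(√log k / 2^j), and there are only (2n+1)^(4^j) of them. The entropy cancels the
gain in accuracy, so each level costs O(R √log k √log n), where R bounds ‖Φx‖_2. After log₂ n levels
the remainder is handled by grouping equal rows.

Finally R² = k(sup deviation + α²), and Jensen gives the factor √(E_α + α²). Solving this
self-bounding inequality gives the second claim. -/

namespace RandomHadamard

/-! ### Rademacher sums -/

/-- The sign attached to a Boolean. -/
def sgn (b : Bool) : ℝ := if b then 1 else -1

theorem sum_prod_apply {κ Ω : Type*} [Fintype κ] [DecidableEq κ] [Fintype Ω] (f : κ → Ω → ℝ) :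
    ∑ ω : κ → Ω, ∏ i, f i (ω i) = ∏ i, ∑ w, f i w := by
  simp only [Finset.prod_univ_sum, Fintype.piFinset_univ]

theorem expect_exp_sum_sgn_le {κ : Type*} [Fintype κ] [DecidableEq κ] (c : κ → ℝ) :
    𝔼 r : κ → Bool, Real.exp (∑ i, sgn (r i) * c i) ≤ Real.exp ((∑ i, c i ^ 2) / 2) := by
  have h := sum_prod_apply (κ := κ) (Ω := Bool) fun i b => Real.exp (sgn b * c i)
  have h2 : ∑ r : κ → Bool, Real.exp (∑ i, sgn (r i) * c i) =
      ∏ i, (Real.exp (c i) + Real.exp (-c i)) := by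
    simp only [Real.exp_sum]
    rw [h]
    simp [sgn]
  rw [Fintype.expect_eq_sum_div_card, h2, Finset.sum_div, Real.exp_sum]
  have hc : ((Fintype.card (κ → Bool) : ℕ) : ℝ) = ∏ _i : κ, 2 := by simp
  rw [hc, ← Finset.prod_div_distrib]
  refine Finset.prod_le_prod (fun i _ => by positivity) fun i _ => ?_
  rw [← Real.cosh_eq]
  exact Real.cosh_le_exp_half_sq _

/-- Maximal inequality for subgaussian variables: the maximum is dominated by the sum of the
exponential moments of ±Z_t, and only log M is lost. -/
theorem expect_norm_sum_sgn_le {κ τ : Type*} [Fintype κ] [DecidableEq κ] [Fintype τ] [Nonempty τ]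
    (c : τ → κ → ℝ) {σ : ℝ} (hσ : 0 < σ) (hc : ∀ t, ∑ i, c t i ^ 2 ≤ σ ^ 2) {M : ℕ}
    (hM : Fintype.card τ ≤ M) :
    𝔼 r : κ → Bool, ‖fun t => ∑ i, sgn (r i) * c t i‖ ≤ σ * √(2 * Real.log (2 * M)) := by
  have hM1 : 1 ≤ M := Fintype.card_pos.trans_le hM
  have hM1' : (1 : ℝ) ≤ M := by exact_mod_cast hM1
  set L := Real.log (2 * M)
  have hL : 0 < L := Real.log_pos (by linarith)
  set s := √(2 * L)
  have hs : 0 < s := Real.sqrt_pos.2 (by linarith)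
  have hss : s ^ 2 = 2 * L := Real.sq_sqrt (by linarith)
  -- With lam²σ²/2 = L, each moment is at most e^L = 2M, so the 2M or fewer of them sum to at most
  -- e^(2L).
  set lam := s / σ
  have hl : 0 < lam := div_pos hs hσ
  have hls : lam ^ 2 * σ ^ 2 = 2 * L := by
    rw [← hss]; simp only [lam]; field_simp
  -- The tangent to exp at 2L replaces the logarithm and Jensen's inequality.
  have key : ∀ r : κ → Bool, lam * ‖fun t => ∑ i, sgn (r i) * c t i‖ ≤ 2 * L - 1 +
      Real.exp (-(2 * L)) * ∑ t, (Real.exp (∑ i, sgn (r i) * (lam * c t i)) +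
        Real.exp (∑ i, sgn (r i) * (-lam * c t i))) := by
    intro r
    rw [← le_div_iff₀' hl, pi_norm_le_iff_of_nonempty]
    intro t
    rw [le_div_iff₀' hl, Real.norm_eq_abs]
    set Z := ∑ i, sgn (r i) * c t i with hZ
    have e1 : ∑ i, sgn (r i) * (lam * c t i) = lam * Z := by
      rw [hZ, Finset.mul_sum]; exact Finset.sum_congr rfl fun i _ => by ring
    have e2 : ∑ i, sgn (r i) * (-lam * c t i) = -(lam * Z) := by
      rw [hZ, Finset.mul_sum, ← Finset.sum_neg_distrib]
      exact Finset.sum_congr rfl fun i _ => by ring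
    have h1 := Finset.single_le_sum (f := fun t => Real.exp (∑ i, sgn (r i) * (lam * c t i)) +
        Real.exp (∑ i, sgn (r i) * (-lam * c t i))) (fun i _ => by positivity) (Finset.mem_univ t)
    simp only [e1, e2] at h1
    have h2 : Real.exp (lam * |Z|) ≤ Real.exp (lam * Z) + Real.exp (-(lam * Z)) := by
      rcases abs_cases Z with ⟨h, _⟩ | ⟨h, _⟩ <;> rw [h]
      · linarith [Real.exp_pos (-(lam * Z))]
      · rw [mul_neg]; linarith [Real.exp_pos (lam * Z)]
    have h3 := Real.add_one_le_exp (lam * |Z| - 2 * L)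
    have h4 : Real.exp (lam * |Z| - 2 * L) = Real.exp (-(2 * L)) * Real.exp (lam * |Z|) := by
      rw [← Real.exp_add]; ring_nf
    have h5 := mul_le_mul_of_nonneg_left (h2.trans h1) (Real.exp_pos (-(2 * L))).le
    linarith
  have hmgf : ∀ (t : τ) (a : ℝ), a ^ 2 = lam ^ 2 →
      𝔼 r : κ → Bool, Real.exp (∑ i, sgn (r i) * (a * c t i)) ≤ Real.exp L := by
    intro t a ha
    refine (expect_exp_sum_sgn_le _).trans (Real.exp_le_exp.2 ?_)
    simp only [mul_pow, ha, ← Finset.mul_sum]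
    have := mul_le_mul_of_nonneg_left (hc t) (sq_nonneg lam)
    linarith
  have h1 : lam * 𝔼 r : κ → Bool, ‖fun t => ∑ i, sgn (r i) * c t i‖ ≤ 2 * L := by
    rw [Finset.mul_expect]
    refine (Finset.expect_le_expect fun r _ => key r).trans ?_
    rw [Finset.expect_add_distrib, Fintype.expect_const, ← Finset.mul_expect,
      Finset.expect_sum_comm]
    have h2 : ∑ t, 𝔼 r : κ → Bool, (Real.exp (∑ i, sgn (r i) * (lam * c t i)) +
        Real.exp (∑ i, sgn (r i) * (-lam * c t i))) ≤ ∑ _t : τ, 2 * Real.exp L := by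
      refine Finset.sum_le_sum fun t _ => ?_
      rw [Finset.expect_add_distrib]
      linarith [hmgf t lam rfl, hmgf t (-lam) (by ring)]
    have h3 : ∑ _t : τ, 2 * Real.exp L ≤ Real.exp (2 * L) := by
      have h4 : Real.exp L = 2 * M := Real.exp_log (by linarith)
      rw [two_mul L, Real.exp_add, Finset.sum_const, nsmul_eq_mul, Finset.card_univ]
      have h5 : (Fintype.card τ : ℝ) ≤ M := by exact_mod_cast hM
      rw [← mul_assoc]
      refine mul_le_mul_of_nonneg_right ?_ (Real.exp_pos L).le
      rw [h4]; linarith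
    have h6 := mul_le_mul_of_nonneg_left (h2.trans h3) (Real.exp_pos (-(2 * L))).le
    rw [← Real.exp_add, neg_add_cancel, Real.exp_zero] at h6
    linarith
  rw [← le_div_iff₀' hl] at h1
  refine h1.trans (le_of_eq ?_)
  rw [← hss]; simp only [lam]; field_simp

/-- Only the number of labels enters the logarithm: one representative per attained label suffices.
In the chaining, τ is enormous but labels are few. -/
theorem expect_norm_sum_sgn_le_of_factor {κ τ β : Type*} [Fintype κ] [DecidableEq κ] [Fintype τ]
    [Nonempty τ] [Fintype β] (q : τ → β) (c : τ → κ → ℝ) (hq : ∀ s t, q s = q t → c s = c t)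
    {σ : ℝ} (hσ : 0 < σ) (hc : ∀ t, ∑ i, c t i ^ 2 ≤ σ ^ 2) {M : ℕ}
    (hM : Fintype.card β ≤ M) :
    𝔼 r : κ → Bool, ‖fun t => ∑ i, sgn (r i) * c t i‖ ≤ σ * √(2 * Real.log (2 * M)) := by
  classical
  let c' : Set.range q → κ → ℝ := fun b => c b.2.choose
  have hc' : ∀ t, c' ⟨q t, t, rfl⟩ = c t := fun t =>
    hq _ _ (Set.mem_range_self (f := q) t).choose_spec
  have : Nonempty (Set.range q) := Set.Nonempty.to_subtype (Set.range_nonempty q)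
  refine le_trans (Finset.expect_le_expect fun r _ => ?_)
    (expect_norm_sum_sgn_le c' hσ (fun b => hc _)
      ((Fintype.card_le_of_injective _ Subtype.val_injective).trans hM))
  rw [pi_norm_le_iff_of_nonempty]
  intro t
  rw [← hc' t]
  exact norm_le_pi_norm (fun b => ∑ i, sgn (r i) * c' b i) ⟨q t, t, rfl⟩

/-! ### Symmetrization -/

/-- Exchange the coordinates of a pair of families where `r` is false. -/
def exchange {κ Ω : Type*} (r : κ → Bool) : (κ → Ω) × (κ → Ω) ≃ (κ → Ω) × (κ → Ω) :=
  Function.Involutive.toPerm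
    (fun x => (fun i => if r i then x.1 i else x.2 i, fun i => if r i then x.2 i else x.1 i))
    (fun x => by ext i <;> dsimp only <;> split <;> rfl)

theorem exchange_fst {κ Ω : Type*} (r : κ → Bool) (x : (κ → Ω) × (κ → Ω)) (i : κ) :
    (exchange r x).1 i = if r i then x.1 i else x.2 i := rfl

theorem exchange_snd {κ Ω : Type*} (r : κ → Bool) (x : (κ → Ω) × (κ → Ω)) (i : κ) :
    (exchange r x).2 i = if r i then x.2 i else x.1 i := rfl

section Symmetrization

variable {κ Ω : Type*} [Fintype κ] [DecidableEq κ] [Fintype Ω]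

theorem sum_prod_weight (p : Ω → ℝ) (hp : ∑ w, p w = 1) :
    ∑ ω : κ → Ω, ∏ i, p (ω i) = 1 := by
  have h := sum_prod_apply (κ := κ) fun _ => p
  simp only [hp, Finset.prod_const_one] at h
  exact h

theorem sum_prod_weight_smul {V : Type*} [AddCommGroup V] [Module ℝ V] (p : Ω → ℝ)
    (hp : ∑ w, p w = 1) (v : Ω → V) (i : κ) :
    ∑ ω : κ → Ω, (∏ j, p (ω j)) • v (ω i) = ∑ w, p w • v w := by
  classical
  have hm : ∀ w, ∑ ω : κ → Ω, (∏ j, p (ω j)) * (if ω i = w then 1 else 0) = p w := by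
    intro w
    have h := sum_prod_apply (κ := κ) fun j u => p u * (if j = i then if u = w then 1 else 0 else 1)
    simp only [Finset.prod_mul_distrib, Finset.prod_ite_eq', Finset.mem_univ, if_true] at h
    have h2 : ∏ j : κ, ∑ u, p u * (if j = i then if u = w then (1 : ℝ) else 0 else 1) = p w := by
      rw [Finset.prod_eq_single i]
      · simp
      · intro j _ hj; simp [hj, hp]
      · simp
    rw [h2] at h
    convert h
  calc ∑ ω : κ → Ω, (∏ j, p (ω j)) • v (ω i)
      = ∑ ω : κ → Ω, ∑ w, ((∏ j, p (ω j)) * (if ω i = w then 1 else 0)) • v w := by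
        refine Finset.sum_congr rfl fun ω _ => ?_
        rw [Finset.sum_eq_single (ω i)]
        · simp
        · intro w _ hw; simp [Ne.symm hw]
        · simp
    _ = ∑ w, p w • v w := by
        rw [Finset.sum_comm]
        simp only [← Finset.sum_smul, hm]

/-- The mean is replaced by an independent copy. For each sign pattern r, exchanging the two samples
where r is false preserves the product weight and puts the signs on the differences; the triangle
inequality separates the two copies. -/
theorem sum_weight_norm_sub_le {V : Type*} [SeminormedAddCommGroup V] [NormedSpace ℝ V]
    (p : Ω → ℝ) (hp0 : ∀ w, 0 ≤ p w) (hp : ∑ w, p w = 1) (v : Ω → V) :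
    ∑ ω : κ → Ω, (∏ i, p (ω i)) * ‖∑ i, v (ω i) - (Fintype.card κ : ℝ) • ∑ w, p w • v w‖ ≤
      2 * ∑ ω : κ → Ω, (∏ i, p (ω i)) * 𝔼 r : κ → Bool, ‖∑ i, sgn (r i) • v (ω i)‖ := by
  set P : (κ → Ω) → ℝ := fun ω => ∏ i, p (ω i) with hP
  have hP0 : ∀ ω, 0 ≤ P ω := fun ω => Finset.prod_nonneg fun i _ => hp0 _
  have hP1 : ∑ ω, P ω = 1 := sum_prod_weight p hp
  let G : (κ → Ω) × (κ → Ω) → ℝ := fun x => P x.1 * P x.2 * ‖∑ i, (v (x.1 i) - v (x.2 i))‖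
  have hmean : ∑ ω, P ω • ∑ i, v (ω i) = (Fintype.card κ : ℝ) • ∑ w, p w • v w := by
    simp only [Finset.smul_sum]
    rw [Finset.sum_comm]
    simp only [hP, sum_prod_weight_smul p hp v]
    rw [Finset.sum_const, Finset.card_univ, ← Finset.smul_sum, Nat.cast_smul_eq_nsmul]
  have h1 : ∑ ω, P ω * ‖∑ i, v (ω i) - (Fintype.card κ : ℝ) • ∑ w, p w • v w‖ ≤ ∑ x, G x := by
    rw [Fintype.sum_prod_type]
    refine Finset.sum_le_sum fun ω _ => ?_
    simp only [G, mul_assoc]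
    rw [← Finset.mul_sum]
    refine mul_le_mul_of_nonneg_left ?_ (hP0 ω)
    have : ∑ i, v (ω i) - (Fintype.card κ : ℝ) • ∑ w, p w • v w =
        ∑ ω', P ω' • ∑ i, (v (ω i) - v (ω' i)) := by
      simp only [Finset.sum_sub_distrib, smul_sub]
      rw [hmean, ← Finset.sum_smul, hP1, one_smul]
    rw [this]
    refine (norm_sum_le _ _).trans (Finset.sum_le_sum fun ω' _ => ?_)
    rw [norm_smul, Real.norm_of_nonneg (hP0 _)]
  let H : (κ → Bool) → ℝ := fun r => ∑ ω, P ω * ‖∑ i, sgn (r i) • v (ω i)‖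
  have h2 : ∀ r : κ → Bool, ∑ x, G x ≤ 2 * H r := by
    intro r
    rw [← Equiv.sum_comp (exchange r) G]
    have h3 : ∀ x, G (exchange r x) ≤ P x.1 * P x.2 * ‖∑ i, sgn (r i) • v (x.1 i)‖ +
        P x.1 * P x.2 * ‖∑ i, sgn (r i) • v (x.2 i)‖ := by
      intro x
      have e1 : P (exchange r x).1 * P (exchange r x).2 = P x.1 * P x.2 := by
        simp only [hP, ← Finset.prod_mul_distrib]
        refine Finset.prod_congr rfl fun i _ => ?_
        rw [exchange_fst, exchange_snd]
        split
        · rfl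
        · ring
      have e2 : ∑ i, (v ((exchange r x).1 i) - v ((exchange r x).2 i)) =
          ∑ i, sgn (r i) • v (x.1 i) - ∑ i, sgn (r i) • v (x.2 i) := by
        rw [← Finset.sum_sub_distrib]
        refine Finset.sum_congr rfl fun i _ => ?_
        rw [exchange_fst, exchange_snd, sgn]
        split
        · simp
        · simp [neg_add_eq_sub]
      simp only [G]
      rw [e1, e2, ← mul_add]
      exact mul_le_mul_of_nonneg_left (norm_sub_le _ _) (mul_nonneg (hP0 _) (hP0 _))
    refine (Finset.sum_le_sum fun x _ => h3 x).trans (le_of_eq ?_)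
    rw [Finset.sum_add_distrib, two_mul]
    congr 1
    · rw [Fintype.sum_prod_type]
      refine Finset.sum_congr rfl fun ω _ => ?_
      simp only [mul_right_comm _ _ ‖_‖]
      rw [← Finset.mul_sum, hP1, mul_one]
    · rw [Fintype.sum_prod_type]
      simp only [mul_assoc]
      simp only [← Finset.mul_sum]
      rw [← Finset.sum_mul, hP1, one_mul]
  refine h1.trans ?_
  have h4 : ∑ ω, P ω * 𝔼 r : κ → Bool, ‖∑ i, sgn (r i) • v (ω i)‖ = 𝔼 r, H r := by
    simp only [H, Finset.mul_expect]
    rw [Finset.expect_sum_comm]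
  rw [h4, Finset.mul_expect, ← Fintype.expect_const (ι := κ → Bool) (∑ x, G x)]
  exact Finset.expect_le_expect fun r _ => h2 r

end Symmetrization

/-! ### Empirical approximation of points of the cross-polytope -/

/-- The columns of a matrix, with signs, together with the zero vector. -/
def signedCol {ι κ : Type*} (φ : κ → ι → ℝ) : Option (ι × Bool) → κ → ℝ
  | none => 0
  | some (t, b) => fun i => sgn b * φ i t

theorem abs_signedCol_le {ι κ : Type*} {φ : κ → ι → ℝ} (hφ : ∀ i t, |φ i t| ≤ 1)
    (u : Option (ι × Bool)) (i : κ) : |signedCol φ u i| ≤ 1 := by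
  rcases u with _ | ⟨t, _ | _⟩ <;> simp [signedCol, sgn, hφ]

/-- Maurey's empirical method: the target is the mean of a random signed column. By symmetrization
and the maximal inequality over the coordinates i, m independent samples achieve the bound on
average, hence for some choice. -/
theorem exists_empirical_approx {ι κ : Type*} [Fintype ι] [Fintype κ] [Nonempty κ]
    {φ : κ → ι → ℝ} (hφ : ∀ i t, |φ i t| ≤ 1) {x : ι → ℝ} (hx : ∑ t, |x t| ≤ 1) {m : ℕ}
    (hm : 0 < m) :
    ∃ η : Fin m → Option (ι × Bool), ∀ i,
      |∑ t, φ i t * x t - (1 / (m : ℝ)) * ∑ l, signedCol φ (η l) i| ≤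
        2 * √(2 * Real.log (2 * Fintype.card κ)) / √m := by
  have hm' : (0 : ℝ) < m := by exact_mod_cast hm
  -- Mass |x t| goes to column t with the sign of x t; the zero vector absorbs the mass missing from
  -- 1.
  let p : Option (ι × Bool) → ℝ := fun u =>
    u.elim (1 - ∑ t, |x t|) fun tb => max (sgn tb.2 * x tb.1) 0
  have hp0 : ∀ u, 0 ≤ p u := by
    rintro (_ | tb)
    · simpa [p] using hx
    · exact le_max_right _ _
  have hbool : ∀ a : ℝ, max (1 * a) 0 + max (-1 * a) 0 = |a| := by
    intro a
    rcases le_total 0 a with h | h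
    · rw [max_eq_left (by linarith), max_eq_right (by linarith), abs_of_nonneg h]; ring
    · rw [max_eq_right (by linarith), max_eq_left (by linarith), abs_of_nonpos h]; ring
  have hbool' : ∀ a : ℝ, max (1 * a) 0 - max (-1 * a) 0 = a := by
    intro a
    rcases le_total 0 a with h | h
    · rw [max_eq_left (by linarith), max_eq_right (by linarith)]; ring
    · rw [max_eq_right (by linarith), max_eq_left (by linarith)]; ring
  have hp : ∑ u, p u = 1 := by
    rw [Fintype.sum_option, Fintype.sum_prod_type]
    simp only [p, Option.elim, Fintype.sum_bool, sgn, if_true, Bool.false_eq_true, if_false, hbool]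
    ring
  have hmean : ∑ u, p u • signedCol φ u = fun i => ∑ t, φ i t * x t := by
    rw [Fintype.sum_option, Fintype.sum_prod_type]
    funext i
    simp only [p, Option.elim, signedCol, Finset.sum_apply, Fintype.sum_bool, Pi.add_apply,
      Pi.zero_apply, mul_zero, zero_add, Pi.smul_apply, smul_eq_mul, sgn, if_true,
      Bool.false_eq_true, if_false]
    refine Finset.sum_congr rfl fun t _ => ?_
    calc _ = φ i t * (max (1 * x t) 0 - max (-1 * x t) 0) := by ring
      _ = _ := by rw [hbool']
  set s := √(2 * Real.log (2 * Fintype.card κ))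
  have hsym := sum_weight_norm_sub_le (κ := Fin m) p hp0 hp (signedCol φ)
  rw [hmean, Fintype.card_fin] at hsym
  have hr : ∀ η : Fin m → Option (ι × Bool),
      𝔼 r : Fin m → Bool, ‖∑ l, sgn (r l) • signedCol φ (η l)‖ ≤ √m * s := by
    intro η
    have h := expect_norm_sum_sgn_le (fun i l => signedCol φ (η l) i) (Real.sqrt_pos.2 hm')
      (fun i => by
        rw [Real.sq_sqrt hm'.le]
        calc ∑ l, signedCol φ (η l) i ^ 2 ≤ ∑ _l : Fin m, (1 : ℝ) :=
              Finset.sum_le_sum fun l _ => (sq_le_one_iff_abs_le_one _).2 (abs_signedCol_le hφ _ _)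
          _ = m := by simp) le_rfl
    refine le_of_eq_of_le (Finset.expect_congr rfl fun r _ => ?_) h
    congr 1
    funext i
    simp [Finset.sum_apply]
  have hW1 := sum_prod_weight (κ := Fin m) p hp
  have hW0 : ∀ η : Fin m → Option (ι × Bool), 0 ≤ ∏ l, p (η l) := fun η =>
    Finset.prod_nonneg fun _ _ => hp0 _
  have hE : ∑ η : Fin m → Option (ι × Bool), (∏ l, p (η l)) *
      ‖∑ l, signedCol φ (η l) - (m : ℝ) • fun i => ∑ t, φ i t * x t‖ ≤ 2 * (√m * s) := by
    refine hsym.trans (mul_le_mul_of_nonneg_left ?_ zero_le_two)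
    refine (Finset.sum_le_sum fun η _ => mul_le_mul_of_nonneg_left (hr η) (hW0 η)).trans ?_
    rw [← Finset.sum_mul, hW1, one_mul]
  obtain ⟨η, hη⟩ : ∃ η : Fin m → Option (ι × Bool),
      ‖∑ l, signedCol φ (η l) - (m : ℝ) • fun i => ∑ t, φ i t * x t‖ ≤ 2 * (√m * s) := by
    by_contra! hcon
    obtain ⟨η₀, -, hη₀⟩ := Finset.exists_ne_zero_of_sum_ne_zero (hW1.trans_ne one_ne_zero)
    have hlt := Finset.sum_lt_sum
      (fun η _ => mul_le_mul_of_nonneg_left (hcon η).le (hW0 η))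
      ⟨η₀, Finset.mem_univ _,
        mul_lt_mul_of_pos_left (hcon η₀) (lt_of_le_of_ne (hW0 η₀) (Ne.symm hη₀))⟩
    rw [← Finset.sum_mul, hW1, one_mul] at hlt
    exact absurd hE (not_le.2 hlt)
  refine ⟨η, fun i => ?_⟩
  have h1 := (norm_le_pi_norm _ i).trans hη
  rw [Real.norm_eq_abs, Pi.sub_apply, Finset.sum_apply, Pi.smul_apply, smul_eq_mul] at h1
  have h2 : ∑ t, φ i t * x t - (1 / (m : ℝ)) * ∑ l, signedCol φ (η l) i =
      -((1 / (m : ℝ)) * (∑ l, signedCol φ (η l) i - m * ∑ t, φ i t * x t)) := by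
    field_simp; ring
  rw [h2, abs_neg, abs_mul, abs_of_pos (by positivity : 0 < 1 / (m : ℝ))]
  calc (1 / (m : ℝ)) * _ ≤ (1 / (m : ℝ)) * (2 * (√m * s)) :=
        mul_le_mul_of_nonneg_left h1 (by positivity)
    _ = 2 * s / √m := by
        have : (m : ℝ) = √m * √m := (Real.mul_self_sqrt hm'.le).symm
        have h3 : 0 < √(m : ℝ) := Real.sqrt_pos.2 hm'
        rw [div_mul_eq_mul_div, one_mul, div_eq_div_iff hm'.ne' h3.ne']
        linear_combination (2 * s) * this.symm

/-! ### Rademacher sums of squares -/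

/-- Equal indices are grouped: the signs over a fibre of size c sum to O(√c) in mean, so the cost
depends on the number of values of ω and not on that of indices. -/
theorem expect_norm_sum_sgn_le_of_card {κ τ W : Type*} [Fintype κ] [DecidableEq κ] [Fintype τ]
    [Nonempty τ] [Fintype W] [DecidableEq W] (ω : κ → W) (b : W → τ → ℝ) {B : ℝ} (hB : 0 ≤ B)
    (hb : ∀ w s, √(Finset.card {i | ω i = w}) * |b w s| ≤ B) :
    𝔼 r : κ → Bool, ‖fun s => ∑ i, sgn (r i) * b (ω i) s‖ ≤
      Fintype.card W * (B * √(2 * Real.log 2)) := by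
  have h1 : ∀ r : κ → Bool, ‖fun s => ∑ i, sgn (r i) * b (ω i) s‖ ≤
      ∑ w, |∑ i, sgn (r i) * (if ω i = w then 1 else 0)| * ‖b w‖ := by
    intro r
    have : (fun s => ∑ i, sgn (r i) * b (ω i) s) =
        ∑ w, (∑ i, sgn (r i) * (if ω i = w then 1 else 0)) • b w := by
      funext s
      simp only [Finset.sum_apply, Pi.smul_apply, smul_eq_mul, Finset.sum_mul]
      rw [Finset.sum_comm]
      simp
    rw [this]
    refine (norm_sum_le _ _).trans (le_of_eq ?_)
    simp only [norm_smul, Real.norm_eq_abs]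
  refine (Finset.expect_le_expect fun r _ => h1 r).trans ?_
  rw [Finset.expect_sum_comm]
  calc ∑ w, 𝔼 r : κ → Bool, |∑ i, sgn (r i) * (if ω i = w then 1 else 0)| * ‖b w‖
      ≤ ∑ _w : W, B * √(2 * Real.log 2) := Finset.sum_le_sum fun w _ => ?_
    _ = _ := by simp
  rw [← Finset.expect_mul]
  rcases Nat.eq_zero_or_pos (Finset.card {i | ω i = w}) with h0 | hpos
  · have h2 : ∀ i, ω i ≠ w := by simpa [Finset.filter_eq_empty_iff] using h0
    simp only [h2, if_false, mul_zero, Finset.sum_const_zero, abs_zero, Finset.expect_const_zero,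
      zero_mul]
    positivity
  · have hpos' : (0 : ℝ) < (Finset.card {i | ω i = w} : ℕ) := by exact_mod_cast hpos
    have h3 := expect_norm_sum_sgn_le (τ := Unit)
      (fun _ i => if ω i = w then (1 : ℝ) else 0) (Real.sqrt_pos.2 hpos')
      (fun _ => by rw [Real.sq_sqrt hpos'.le]; simp [ite_pow]) (M := 1) (by simp)
    simp only [pi_norm_const, Real.norm_eq_abs, Nat.cast_one] at h3
    rw [mul_one (2 : ℝ)] at h3
    refine (mul_le_mul_of_nonneg_right h3 (norm_nonneg _)).trans ?_
    rw [mul_right_comm]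
    refine mul_le_mul_of_nonneg_right ?_ (Real.sqrt_nonneg _)
    rw [← le_div_iff₀' (Real.sqrt_pos.2 hpos'), pi_norm_le_iff_of_nonempty]
    intro s
    rw [le_div_iff₀' (Real.sqrt_pos.2 hpos')]
    exact hb w s

/-- In a² - b² = (a - b)(a + b), the first factor is uniformly small and the second is bounded in
ℓ². -/
theorem sum_sq_sub_sq_sq_le {κ : Type*} [Fintype κ] {a b : κ → ℝ} {R δ : ℝ}
    (ha : ∑ i, a i ^ 2 ≤ R ^ 2) (hb : ∑ i, b i ^ 2 ≤ R ^ 2) (hab : ∀ i, |a i - b i| ≤ δ) :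
    ∑ i, (a i ^ 2 - b i ^ 2) ^ 2 ≤ (2 * R * δ) ^ 2 := by
  calc ∑ i, (a i ^ 2 - b i ^ 2) ^ 2 ≤ ∑ i, δ ^ 2 * (2 * a i ^ 2 + 2 * b i ^ 2) := by
        refine Finset.sum_le_sum fun i _ => ?_
        have h1 : (a i - b i) ^ 2 ≤ δ ^ 2 := sq_le_sq' (neg_le_of_abs_le (hab i))
          (le_of_abs_le (hab i))
        have h2 : (a i + b i) ^ 2 ≤ 2 * a i ^ 2 + 2 * b i ^ 2 := by
          linarith [sq_nonneg (a i - b i)]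
        calc (a i ^ 2 - b i ^ 2) ^ 2 = (a i - b i) ^ 2 * (a i + b i) ^ 2 := by ring
          _ ≤ _ := mul_le_mul h1 h2 (sq_nonneg _) (sq_nonneg _)
    _ = δ ^ 2 * (2 * ∑ i, a i ^ 2 + 2 * ∑ i, b i ^ 2) := by
        rw [← Finset.mul_sum, Finset.sum_add_distrib, ← Finset.mul_sum, ← Finset.mul_sum]
    _ ≤ δ ^ 2 * (2 * R ^ 2 + 2 * R ^ 2) :=
        mul_le_mul_of_nonneg_left (by linarith) (sq_nonneg _)
    _ = (2 * R * δ) ^ 2 := by ring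

/-- A chain of length `d` between a family and its approximations. -/
theorem norm_le_chain {τ κ : Type*} [Fintype τ] [Fintype κ] (A : τ → κ → ℝ) (π : ℕ → τ → τ)
    (e : κ → ℝ) (d : ℕ) :
    ‖fun s => ∑ i, e i * A s i‖ ≤ ‖fun s => ∑ i, e i * A (π 0 s) i‖ +
      ∑ j ∈ Finset.range d, ‖fun s => ∑ i, e i * (A (π (j + 1) s) i - A (π j s) i)‖ +
      ‖fun s => ∑ i, e i * (A s i - A (π d s) i)‖ := by
  have h : (fun s => ∑ i, e i * A s i) = (fun s => ∑ i, e i * A (π 0 s) i) +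
      ∑ j ∈ Finset.range d, (fun s => ∑ i, e i * (A (π (j + 1) s) i - A (π j s) i)) +
      fun s => ∑ i, e i * (A s i - A (π d s) i) := by
    funext s
    have h1 := Finset.sum_range_sub (fun j => ∑ i, e i * A (π j s) i) d
    simp only [Finset.sum_sub_distrib] at h1
    simp only [Pi.add_apply, Finset.sum_apply, mul_sub, Finset.sum_sub_distrib, h1]
    ring
  rw [h]
  refine (norm_add_le _ _).trans (add_le_add_left ((norm_add_le _ _).trans ?_) _)
  exact add_le_add_right (norm_sum_le _ _) _

theorem expect_norm_sum_sgn_sq_le {κ ι τ W : Type*} [Fintype κ] [DecidableEq κ] [Fintype ι]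
    [Fintype τ] [Nonempty τ] [Fintype W] {d : ℕ} (hd : 1 ≤ d)
    (hι : Fintype.card ι = 2 ^ d) (hW : Fintype.card W = 2 ^ d) (hκ : 2 ≤ Fintype.card κ)
    {h : W → ι → ℝ} (hh : ∀ w t, |h w t| ≤ 1) {x : τ → ι → ℝ} (hx : ∀ s, ∑ t, |x s t| ≤ 1)
    (ω : κ → W) {R : ℝ} (hR0 : 0 < R) (hR : ∀ s, ∑ i, (∑ t, h (ω i) t * x s t) ^ 2 ≤ R ^ 2) :
    𝔼 r : κ → Bool, ‖fun s => ∑ i, sgn (r i) * (∑ t, h (ω i) t * x s t) ^ 2‖ ≤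
      300 * d * √(Real.log (2 ^ d)) * √(Real.log (Fintype.card κ)) * R := by
  classical
  have : Nonempty κ := Fintype.card_pos_iff.1 (by omega)
  have hK : (2 : ℝ) ≤ Fintype.card κ := by exact_mod_cast hκ
  set A : τ → κ → ℝ := fun s i => ∑ t, h (ω i) t * x s t with hA
  set S := √(2 * Real.log (2 * Fintype.card κ)) with hS
  have hS1 : 1 ≤ S := by
    rw [hS, Real.one_le_sqrt]
    have := Real.log_le_log (by norm_num) (by linarith : (2 : ℝ) ≤ 2 * Fintype.card κ)
    linarith [Real.log_two_gt_d9]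
  have hS0 : 0 < S := by linarith
  have hnet : ∀ (j : ℕ) (s : τ), ∃ η : Fin (4 ^ j) → Option (ι × Bool), ∀ i,
      |A s i - (1 / ((4 ^ j : ℕ) : ℝ)) * ∑ l, signedCol (fun i => h (ω i)) (η l) i| ≤
        2 * S / 2 ^ j := by
    intro j s
    obtain ⟨η, hη⟩ := exists_empirical_approx (φ := fun i => h (ω i)) (fun i t => hh _ _) (hx s)
      (m := 4 ^ j) (by positivity)
    refine ⟨η, fun i => (hη i).trans (le_of_eq ?_)⟩
    have : √((4 ^ j : ℕ) : ℝ) = 2 ^ j := by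
      rw [Real.sqrt_eq_iff_mul_self_eq (by positivity) (by positivity)]
      push_cast
      rw [← mul_pow]; norm_num
    rw [this]
  choose q hq using hnet
  -- The chain runs through members of τ sharing a label, not through the empirical averages, so
  -- that `hR` applies to every link. This doubles the error.
  let π : ℕ → τ → τ := fun j s => Function.invFun (q j) (q j s)
  have hqπ : ∀ j s, q j (π j s) = q j s := fun j s => Function.invFun_eq ⟨s, rfl⟩
  have hπ : ∀ j s i, |A s i - A (π j s) i| ≤ 4 * S / 2 ^ j := by
    intro j s i
    have h1 := hq j s i
    have h2 := hq j (π j s) i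
    rw [hqπ, abs_sub_comm] at h2
    refine (abs_sub_le _ _ _).trans ((add_le_add h1 h2).trans (le_of_eq ?_))
    ring
  have hcard : Fintype.card (Option (ι × Bool)) = 2 ^ (d + 1) + 1 := by
    simp [hι, pow_succ]
  set N := 2 ^ (d + 1) + 1 with hN
  have hN2 : (2 : ℝ) ≤ N := by
    have : 2 ≤ N := by have := Nat.one_le_two_pow (n := d); rw [hN, pow_succ]; omega
    exact_mod_cast this
  have hLN : Real.log 2 ≤ Real.log N := Real.log_le_log (by norm_num) hN2
  have hL2 := (Real.log_pos one_lt_two : 0 < Real.log 2)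
  -- Label pairs at levels j, j + 1 number N^(5·4^j), and 2(5·4^j + 1) ≤ 12·4^j.
  set T := √(12 * Real.log N) with hT
  have hT0 : 0 ≤ T := Real.sqrt_nonneg _
  have hlog : ∀ m : ℕ, Real.log (2 * (N ^ m : ℕ)) ≤ (m + 1) * Real.log N := by
    intro m
    push_cast
    rw [Real.log_mul (by norm_num) (by positivity), Real.log_pow]
    linarith
  -- Since |A| ≤ 1, A⁴ ≤ A², so the base level has variance at most R².
  have level_zero : 𝔼 r : κ → Bool, ‖fun s => ∑ i, sgn (r i) * A (π 0 s) i ^ 2‖ ≤ R * T := by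
    refine (expect_norm_sum_sgn_le_of_factor (q 0) (fun s i => A (π 0 s) i ^ 2) ?_ hR0 ?_
      (M := N ^ 1) ?_).trans ?_
    · intro s t hst; simp only [π, hst]
    · intro s
      refine (Finset.sum_le_sum fun i _ => ?_).trans (hR (π 0 s))
      have h1 : |A (π 0 s) i| ≤ 1 := by
        refine (Finset.abs_sum_le_sum_abs _ _).trans (le_trans ?_ (hx (π 0 s)))
        refine Finset.sum_le_sum fun t _ => ?_
        rw [abs_mul]
        exact mul_le_of_le_one_left (abs_nonneg _) (hh _ _)
      have h2 := (sq_le_one_iff_abs_le_one _).2 h1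
      rw [sq (A (π 0 s) i ^ 2)]
      exact mul_le_of_le_one_left (sq_nonneg _) h2
    · simp [hcard]
    · refine mul_le_mul_of_nonneg_left (Real.sqrt_le_sqrt ?_) hR0.le
      have := hlog 1
      push_cast at this ⊢
      linarith
  have level_succ : ∀ j, 𝔼 r : κ → Bool,
      ‖fun s => ∑ i, sgn (r i) * (A (π (j + 1) s) i ^ 2 - A (π j s) i ^ 2)‖ ≤
        16 * R * S * T := by
    intro j
    have hδ : ∀ s i, |A (π (j + 1) s) i - A (π j s) i| ≤ 8 * S / 2 ^ j := by
      intro s i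
      have h1 := hπ j s i
      have h2 := hπ (j + 1) s i
      rw [abs_sub_comm] at h2
      refine (abs_sub_le _ (A s i) _).trans ((add_le_add h2 h1).trans ?_)
      have : 4 * S / 2 ^ (j + 1) ≤ 4 * S / 2 ^ j := by
        refine div_le_div_of_nonneg_left (by positivity) (by positivity) ?_
        exact pow_le_pow_right₀ (by norm_num) (by omega)
      refine (add_le_add_left this _).trans (le_of_eq ?_)
      ring
    refine (expect_norm_sum_sgn_le_of_factor (fun s => (q j s, q (j + 1) s))
      (fun s i => A (π (j + 1) s) i ^ 2 - A (π j s) i ^ 2) ?_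
      (σ := 2 * R * (8 * S / 2 ^ j)) (by positivity) ?_ (M := N ^ (5 * 4 ^ j)) ?_).trans ?_
    · intro s t hst
      rw [Prod.mk.injEq] at hst
      simp only [π, hst]
    · exact fun s => sum_sq_sub_sq_sq_le (hR _) (hR _) (hδ s)
    · rw [Fintype.card_prod, Fintype.card_fun, Fintype.card_fun, Fintype.card_fin, Fintype.card_fin,
        hcard, ← pow_add]
      refine le_of_eq ?_
      congr 1
      rw [pow_succ]; ring
    · have h1 : 2 * Real.log (2 * (N ^ (5 * 4 ^ j) : ℕ)) ≤ (2 ^ j) ^ 2 * (12 * Real.log N) := by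
        have h2 := hlog (5 * 4 ^ j)
        have h3 : ((2 : ℝ) ^ j) ^ 2 = 4 ^ j := by rw [← pow_mul, mul_comm, pow_mul]; norm_num
        have h4 : (1 : ℝ) ≤ 4 ^ j := one_le_pow₀ (by norm_num)
        rw [h3]
        push_cast at h2 ⊢
        have h5 := mul_le_mul_of_nonneg_right h4 (hL2.le.trans hLN)
        linarith
      have h2 : √(2 * Real.log (2 * (N ^ (5 * 4 ^ j) : ℕ))) ≤ 2 ^ j * T := by
        refine (Real.sqrt_le_sqrt h1).trans (le_of_eq ?_)
        rw [Real.sqrt_mul (by positivity), Real.sqrt_sq (by positivity)]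
      refine (mul_le_mul_of_nonneg_left h2 (by positivity)).trans (le_of_eq ?_)
      field_simp
      ring
  -- The error 4S/2^d cancels the factor 2^d from grouping by row, so d levels suffice whatever the
  -- size of k.
  have remainder : 𝔼 r : κ → Bool,
      ‖fun s => ∑ i, sgn (r i) * (A s i ^ 2 - A (π d s) i ^ 2)‖ ≤ 8 * R * S * T := by
    refine (expect_norm_sum_sgn_le_of_card ω
      (fun w s => (∑ t, h w t * x s t) ^ 2 - (∑ t, h w t * x (π d s) t) ^ 2)
      (B := 2 * R * (4 * S / 2 ^ d)) (by positivity) ?_).trans ?_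
    · intro w s
      set c := √((Finset.card {i | ω i = w} : ℕ) : ℝ) with hc
      have hc0 : 0 ≤ c := Real.sqrt_nonneg _
      rcases Finset.eq_empty_or_nonempty ({i | ω i = w} : Finset κ) with h0 | ⟨i, hi⟩
      · have : c = 0 := by rw [hc, h0]; simp
        rw [this, zero_mul]; positivity
      have hiw : ω i = w := by simpa using hi
      -- The c² indices of the fibre all contribute the same square.
      have hm : ∀ s, c * |A s i| ≤ R := by
        intro s
        refine abs_le_of_sq_le_sq' ?_ hR0.le |>.2
        rw [mul_pow, sq_abs, hc, Real.sq_sqrt (by positivity)]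
        refine le_trans ?_ (hR s)
        calc _ = ∑ i' ∈ ({i | ω i = w} : Finset κ), A s i ^ 2 := by simp
          _ = ∑ i' ∈ ({i | ω i = w} : Finset κ), (∑ t, h (ω i') t * x s t) ^ 2 := by
              refine Finset.sum_congr rfl fun i' hi' => ?_
              have : ω i' = ω i := by rw [hiw]; simpa using hi'
              simp only [hA, this]
          _ ≤ _ := Finset.sum_le_sum_of_subset_of_nonneg (Finset.subset_univ _)
              fun _ _ _ => sq_nonneg _
      have h1 := hπ d s i
      have h2 := hm s
      have h3 := hm (π d s)
      simp only [hA, hiw] at h1 h2 h3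
      set a := ∑ t, h w t * x s t
      set b := ∑ t, h w t * x (π d s) t
      calc c * |a ^ 2 - b ^ 2| = (c * |a + b|) * |a - b| := by
            rw [sq_sub_sq, abs_mul, mul_assoc]
        _ ≤ (c * (|a| + |b|)) * |a - b| := by gcongr; exact abs_add_le _ _
        _ ≤ (2 * R) * (4 * S / 2 ^ d) := by
            refine mul_le_mul ?_ h1 (abs_nonneg _) (by positivity)
            rw [mul_add]; linarith
    · rw [hW]
      have h1 : √(2 * Real.log 2) ≤ T := Real.sqrt_le_sqrt (by linarith)
      calc _ = 8 * R * S * √(2 * Real.log 2) := by push_cast; field_simp; ring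
        _ ≤ _ := mul_le_mul_of_nonneg_left h1 (by positivity)
  have total : 𝔼 r : κ → Bool, ‖fun s => ∑ i, sgn (r i) * A s i ^ 2‖ ≤
      R * T + ∑ _j ∈ Finset.range d, 16 * R * S * T + 8 * R * S * T := by
    refine (Finset.expect_le_expect fun r _ =>
      norm_le_chain (fun s i => A s i ^ 2) π (fun i => sgn (r i)) d).trans ?_
    rw [Finset.expect_add_distrib, Finset.expect_add_distrib, Finset.expect_sum_comm]
    exact add_le_add (add_le_add level_zero (Finset.sum_le_sum fun j _ => level_succ j)) remainder
  refine total.trans ?_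
  have hd' : (1 : ℝ) ≤ d := by exact_mod_cast hd
  have hS2 : S ≤ 2 * √(Real.log (Fintype.card κ)) := by
    have h1 : Real.log (2 * Fintype.card κ) ≤ 2 * Real.log (Fintype.card κ) := by
      rw [Real.log_mul (by norm_num) (by positivity)]
      linarith [Real.log_le_log (by norm_num) hK]
    have h2 : (2 : ℝ) = √(2 ^ 2) := by rw [Real.sqrt_sq (by norm_num)]
    rw [hS, h2, ← Real.sqrt_mul (by norm_num), ← h2]
    exact Real.sqrt_le_sqrt (by linarith)
  have hT2 : T ≤ 6 * √(Real.log (2 ^ d)) := by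
    have h1 : Real.log N ≤ 3 * Real.log (2 ^ d) := by
      have : (N : ℝ) ≤ 2 ^ (3 * d) := by
        have h3 : N ≤ 2 ^ (d + 2) := by
          have := Nat.one_le_two_pow (n := d)
          rw [hN, pow_succ, pow_add]; omega
        exact_mod_cast h3.trans (Nat.pow_le_pow_right (by norm_num) (by omega))
      have := Real.log_le_log (by linarith) this
      rw [Real.log_pow] at this ⊢
      push_cast at this
      linarith
    have h2 : (6 : ℝ) = √(6 ^ 2) := by rw [Real.sqrt_sq (by norm_num)]
    rw [hT, h2, ← Real.sqrt_mul (by norm_num)]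
    exact Real.sqrt_le_sqrt (by linarith)
  -- 25 = 1 + 16 + 8, and then 300 = 25 · 2 · 6.
  calc R * T + ∑ _j ∈ Finset.range d, 16 * R * S * T + 8 * R * S * T
      ≤ 25 * d * (R * S * T) := by
        rw [Finset.sum_const, Finset.card_range, nsmul_eq_mul]
        have h1 : R * T ≤ R * S * T := by
          rw [mul_right_comm]; exact le_mul_of_one_le_right (by positivity) hS1
        have h2 : R * S * T ≤ d * (R * S * T) := le_mul_of_one_le_left (by positivity) hd'
        linarith
    _ ≤ 25 * d * (R * (2 * √(Real.log (Fintype.card κ))) * (6 * √(Real.log (2 ^ d)))) := by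
        gcongr
    _ = _ := by ring

/-! ### Orthogonality of the Hadamard matrix -/

theorem abs_hadamard (d : ℕ) (w t : Fin d → ZMod 2) : |hadamard d w t| = 1 := by
  simp [hadamard, abs_pow]

theorem neg_one_pow_val_add (a b : ZMod 2) :
    (-1 : ℝ) ^ (a + b).val = (-1) ^ a.val * (-1) ^ b.val := by
  rw [ZMod.val_add, ← pow_add, neg_one_pow_eq_pow_mod_two (n := a.val + b.val)]

/-- If u i = 1, translating w by the i-th basis vector flips every sign, so the sum equals its own
negative. -/
theorem sum_hadamard (d : ℕ) (u : Fin d → ZMod 2) :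
    ∑ w, hadamard d w u = if u = 0 then (2 : ℝ) ^ d else 0 := by
  split_ifs with hu
  · simp [hadamard, hu, ZMod.card]
  obtain ⟨i, hi⟩ := Function.ne_iff.1 hu
  have hi1 : u i = 1 := by
    have : ∀ a : ZMod 2, a ≠ 0 → a = 1 := by decide
    exact this _ hi
  have h := Equiv.sum_comp (Equiv.addRight (Pi.single i (1 : ZMod 2))) fun w => hadamard d w u
  have h2 : ∀ w, hadamard d (w + Pi.single i 1) u = -hadamard d w u := by
    intro w
    have : (1 : ZMod 2).val = 1 := rfl
    simp [hadamard, add_dotProduct, neg_one_pow_val_add, hi1, this]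
  simp only [Equiv.coe_addRight, h2, Finset.sum_neg_distrib] at h
  linarith

theorem sum_hadamard_mul_hadamard (d : ℕ) (t u : Fin d → ZMod 2) :
    ∑ w, hadamard d w t * hadamard d w u = if t = u then (2 : ℝ) ^ d else 0 := by
  have h : ∀ w, hadamard d w t * hadamard d w u = hadamard d w (t + u) := by
    intro w
    simp [hadamard, dotProduct_add, neg_one_pow_val_add]
  simp only [h, sum_hadamard]
  have : t + u = 0 ↔ t = u := by
    simp only [funext_iff, Pi.add_apply, Pi.zero_apply, CharTwo.add_eq_zero]
  simp only [this]

theorem sum_hadamard_mulVec_sq (d : ℕ) (x : (Fin d → ZMod 2) → ℝ) :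
    ∑ w, (∑ t, hadamard d w t * x t) ^ 2 = 2 ^ d * ∑ t, x t ^ 2 := by
  have h : ∀ w, (∑ t, hadamard d w t * x t) ^ 2 =
      ∑ t, ∑ u, (hadamard d w t * hadamard d w u) * (x t * x u) := by
    intro w
    rw [sq, Finset.sum_mul_sum]
    exact Finset.sum_congr rfl fun t _ => Finset.sum_congr rfl fun u _ => by ring
  simp only [h]
  rw [Finset.sum_comm, Finset.mul_sum]
  refine Finset.sum_congr rfl fun t _ => ?_
  rw [Finset.sum_comm]
  simp only [← Finset.sum_mul, sum_hadamard_mul_hadamard, ite_mul, zero_mul, Finset.sum_ite_eq,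
    Finset.mem_univ, if_true]
  ring

/-! ### The deviation matrix as a quadratic form -/

section Form

variable {ι : Type} [Fintype ι] {k : ℕ}

/-- The deviation of the quadratic form `‖Φ x‖² / k` from `‖x‖²`. -/
noncomputable def quadDeviation (Φ : Matrix (Fin k) ι ℝ) (x : ι → ℝ) : ℝ :=
  ∑ t, x t ^ 2 - (1 / (k : ℝ)) * ∑ i, (∑ t, Φ i t * x t) ^ 2

theorem mem_lpBall_two {r : ℝ} (hr : 0 ≤ r) {y : ι → ℝ} :
    y ∈ lpBall ι 2 r ↔ ∑ t, y t ^ 2 ≤ r ^ 2 := by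
  change ‖(WithLp.toLp 2 y : EuclideanSpace ℝ ι)‖ ≤ r ↔ _
  rw [EuclideanSpace.norm_eq, Real.sqrt_le_left hr]
  simp

theorem abs_le_of_mem_lpBall_top {r : ℝ} {y : ι → ℝ} (hy : y ∈ lpBall ι ∞ r) (t : ι) :
    |y t| ≤ r :=
  (PiLp.norm_apply_le (WithLp.toLp ∞ y : PiLp ∞ fun _ : ι => ℝ) t).trans hy

variable [DecidableEq ι]

theorem dotProduct_deviation_mulVec (Φ : Matrix (Fin k) ι ℝ) (y z : ι → ℝ) :
    z ⬝ᵥ deviation Φ y *ᵥ z = quadDeviation Φ (y * z) := by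
  have h1 : Matrix.diagonal y *ᵥ z = y * z := by
    funext t; rw [Matrix.mulVec_diagonal, Pi.mul_apply]
  have h2 : ∀ v, z ⬝ᵥ Matrix.diagonal y *ᵥ v = (y * z) ⬝ᵥ v := by
    intro v
    simp only [dotProduct, Matrix.mulVec_diagonal, Pi.mul_apply]
    exact Finset.sum_congr rfl fun t _ => by ring
  rw [deviation, Matrix.sub_mulVec, dotProduct_sub, Matrix.smul_mulVec, dotProduct_smul, sq,
    ← Matrix.mulVec_mulVec, ← Matrix.mulVec_mulVec, ← Matrix.mulVec_mulVec,
    ← Matrix.mulVec_mulVec, h1, h2, h2, Matrix.dotProduct_mulVec _ Φᵀ, Matrix.vecMul_transpose]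
  simp only [quadDeviation, dotProduct, Matrix.mulVec, smul_eq_mul, sq]

theorem deviation_isSymmetric (Φ : Matrix (Fin k) ι ℝ) (y : ι → ℝ) :
    (Matrix.toEuclideanCLM (n := ι) (𝕜 := ℝ) (deviation Φ y)).IsSymmetric := by
  refine ContinuousLinearMap.isSelfAdjoint_iff_isSymmetric.1 ?_
  rw [IsSelfAdjoint, ← map_star, Matrix.star_eq_conjTranspose,
    Matrix.conjTranspose_eq_transpose_of_trivial]
  congr 1
  simp only [deviation, sq, Matrix.transpose_sub, Matrix.transpose_smul, Matrix.transpose_mul,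
    Matrix.diagonal_transpose, Matrix.transpose_transpose, Matrix.mul_assoc]

theorem reApplyInnerSelf_deviation (Φ : Matrix (Fin k) ι ℝ) (y : ι → ℝ) (z : EuclideanSpace ℝ ι) :
    (Matrix.toEuclideanCLM (n := ι) (𝕜 := ℝ) (deviation Φ y)).reApplyInnerSelf z =
      quadDeviation Φ (y * z.ofLp) := by
  rw [ContinuousLinearMap.reApplyInnerSelf_apply, real_inner_comm, Matrix.inner_toEuclideanCLM,
    dotProduct_deviation_mulVec, RCLike.re_to_real]

theorem abs_quadDeviation_le_specNorm (Φ : Matrix (Fin k) ι ℝ) (y : ι → ℝ) {z : ι → ℝ}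
    (hz : ∑ t, z t ^ 2 ≤ 1) : |quadDeviation Φ (y * z)| ≤ specNorm (deviation Φ y) := by
  set T := Matrix.toEuclideanCLM (n := ι) (𝕜 := ℝ) (deviation Φ y)
  set Z : EuclideanSpace ℝ ι := WithLp.toLp 2 z
  have hZ : ‖Z‖ ≤ 1 := by
    rw [EuclideanSpace.norm_eq, Real.sqrt_le_one]
    simpa using hz
  have h := reApplyInnerSelf_deviation Φ y Z
  rw [← h, ContinuousLinearMap.reApplyInnerSelf_apply, RCLike.re_to_real]
  refine (abs_real_inner_le_norm _ _).trans ?_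
  calc ‖T Z‖ * ‖Z‖ ≤ ‖T‖ * 1 * 1 := by
        refine mul_le_mul ((T.le_opNorm Z).trans ?_) hZ (norm_nonneg _) (by positivity)
        exact mul_le_mul_of_nonneg_left hZ (norm_nonneg _)
    _ = specNorm (deviation Φ y) := by rw [mul_one, mul_one]; rfl

/-- For a symmetric operator the norm is the supremum of the absolute Rayleigh quotients. -/
theorem specNorm_deviation_le (Φ : Matrix (Fin k) ι ℝ) (y : ι → ℝ) {C : ℝ} (hC : 0 ≤ C)
    (h : ∀ z : ι → ℝ, ∑ t, z t ^ 2 ≤ 1 → |quadDeviation Φ (y * z)| ≤ C) :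
    specNorm (deviation Φ y) ≤ C := by
  rw [specNorm, ContinuousLinearMap.norm_eq_iSup_rayleighQuotient _ (deviation_isSymmetric Φ y)]
  refine ciSup_le fun z => ?_
  rcases eq_or_ne z 0 with rfl | hz
  · simpa using hC
  have hz' : ‖z‖ ≠ 0 := norm_ne_zero_iff.2 hz
  rw [← ContinuousLinearMap.rayleigh_smul _ z (inv_ne_zero hz')]
  have hn : ‖‖z‖⁻¹ • z‖ = 1 := by rw [norm_smul, norm_inv, norm_norm, inv_mul_cancel₀ hz']
  rw [ContinuousLinearMap.rayleighQuotient, hn, one_pow, div_one, reApplyInnerSelf_deviation]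
  refine h _ ?_
  rw [EuclideanSpace.norm_eq, Real.sqrt_eq_one] at hn
  refine le_of_eq ?_
  simpa only [Real.norm_eq_abs, sq_abs] using hn

theorem specNorm_le_supDeviation (Φ : Matrix (Fin k) ι ℝ) {α : ℝ} {y : ι → ℝ}
    (hy : y ∈ lpBall ι 2 1 ∩ lpBall ι ∞ α) : specNorm (deviation Φ y) ≤ supDeviation Φ α :=
  le_csSup (bddAbove_deviation Φ α) ⟨y, hy, rfl⟩

theorem supDeviation_nonneg (Φ : Matrix (Fin k) ι ℝ) (α : ℝ) : 0 ≤ supDeviation Φ α := by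
  refine Real.sSup_nonneg ?_
  rintro _ ⟨y, -, rfl⟩
  exact norm_nonneg _

theorem exists_abs_quadDeviation_ge (Φ : Matrix (Fin k) ι ℝ) {α δ : ℝ} (hα : 0 ≤ α) (hδ : 0 < δ) :
    ∃ y z : ι → ℝ, y ∈ lpBall ι 2 1 ∩ lpBall ι ∞ α ∧ ∑ t, z t ^ 2 ≤ 1 ∧
      supDeviation Φ α - δ ≤ |quadDeviation Φ (y * z)| := by
  obtain ⟨_, ⟨y, hy, rfl⟩, hlt⟩ :=
    exists_lt_of_lt_csSup (nonempty_deviation Φ hα) (sub_lt_self (supDeviation Φ α) hδ)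
  by_contra! hcon
  have h0 : 0 ≤ supDeviation Φ α - δ :=
    (abs_nonneg _).trans (hcon y 0 hy (by simp)).le
  exact absurd (specNorm_deviation_le Φ y h0 fun z hz => (hcon y z hy hz).le) (not_le.2 hlt)

end Form

/-! ### The expected deviation -/

theorem expDeviation_nonneg (d k : ℕ) (α : ℝ) : 0 ≤ expDeviation d k α :=
  Finset.expect_nonneg fun _ _ => supDeviation_nonneg _ _

/-- When n = 1 every entry of Φ is 1 and the deviation vanishes; the chaining needs d ≥ 1. -/
theorem expDeviation_zero_left {k : ℕ} (hk : 0 < k) {α : ℝ} (hα : 0 ≤ α) :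
    expDeviation 0 k α = 0 := by
  refine Finset.expect_eq_zero fun ω _ => le_antisymm ?_ (supDeviation_nonneg _ _)
  refine csSup_le (nonempty_deviation _ hα) ?_
  rintro _ ⟨y, -, rfl⟩
  refine specNorm_deviation_le _ _ le_rfl fun z _ => le_of_eq (abs_eq_zero.2 ?_)
  have hk' : (k : ℝ) ≠ 0 := by positivity
  simp [quadDeviation, rowMatrix, hadamard, hk', mul_pow]

/-- Jensen's inequality, from the tangent to the square root at m². -/
theorem expect_sqrt_le {β : Type*} [Fintype β] [Nonempty β] (f : β → ℝ) (hf : ∀ b, 0 ≤ f b)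
    (hpos : 0 < 𝔼 b, f b) : 𝔼 b, √(f b) ≤ √(𝔼 b, f b) := by
  set m := √(𝔼 b, f b)
  have hm : 0 < m := Real.sqrt_pos.2 hpos
  have hmm : m * m = 𝔼 b, f b := Real.mul_self_sqrt hpos.le
  have h : ∀ b, √(f b) ≤ (f b) * (1 / (2 * m)) + m / 2 := by
    intro b
    have h1 := Real.mul_self_sqrt (hf b)
    have h2 : f b * (1 / (2 * m)) + m / 2 - √(f b) = (√(f b) - m) ^ 2 / (2 * m) := by
      field_simp; nlinarith
    have h3 : 0 ≤ (√(f b) - m) ^ 2 / (2 * m) := by positivity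
    linarith
  refine (Finset.expect_le_expect fun b _ => h b).trans (le_of_eq ?_)
  rw [Finset.expect_add_distrib, Fintype.expect_const, ← Finset.expect_mul, ← hmm]
  field_simp
  ring

theorem expDeviation_le {d k : ℕ} (hd : 1 ≤ d) (hk : 2 ≤ k) {α : ℝ} (hα : 0 < α) :
    expDeviation d k α ≤
      600 * d * √(Real.log (2 ^ d)) * √(Real.log k) / √k * √(expDeviation d k α + α ^ 2) := by
  have hk0 : (0 : ℝ) < k := by positivity
  set B : ℝ := 300 * d * √(Real.log (2 ^ d)) * √(Real.log k) with hB
  have hB0 : 0 ≤ B := by positivity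
  refine le_of_forall_pos_le_add fun δ hδ => ?_
  set S : (Fin k → Fin d → ZMod 2) → ℝ := fun ω => supDeviation (rowMatrix ω) α with hS
  have hS0 : ∀ ω, 0 ≤ S ω := fun ω => supDeviation_nonneg _ _
  -- One near-maximizer per draw gives a finite index set for the process. The supremum deviation of
  -- draw ω is then seen, up to δ, at coordinate ω.
  choose y z hy hz hyz using fun ω : Fin k → Fin d → ZMod 2 =>
    exists_abs_quadDeviation_ge (rowMatrix ω) hα.le hδ
  set x : (Fin k → Fin d → ZMod 2) → (Fin d → ZMod 2) → ℝ := fun s => y s * z s with hx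
  have hx1 : ∀ s, ∑ t, |x s t| ≤ 1 := by
    intro s
    have h1 := (mem_lpBall_two zero_le_one).1 (hy s).1
    calc ∑ t, |x s t| ≤ ∑ t, (y s t ^ 2 + z s t ^ 2) / 2 := by
          refine Finset.sum_le_sum fun t _ => ?_
          simp only [hx, Pi.mul_apply]
          rw [abs_mul, ← sq_abs (y s t), ← sq_abs (z s t)]
          linarith [sq_nonneg (|y s t| - |z s t|)]
      _ ≤ 1 := by
          rw [← Finset.sum_div, Finset.sum_add_distrib]
          linarith [hz s]
  have hx2 : ∀ s, ∑ t, x s t ^ 2 ≤ α ^ 2 := by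
    intro s
    calc ∑ t, x s t ^ 2 ≤ ∑ t, α ^ 2 * z s t ^ 2 := by
          refine Finset.sum_le_sum fun t _ => ?_
          simp only [hx, Pi.mul_apply, mul_pow]
          refine mul_le_mul_of_nonneg_right ?_ (sq_nonneg _)
          exact sq_le_sq' (neg_le_of_abs_le (abs_le_of_mem_lpBall_top (hy s).2 t))
            (le_of_abs_le (abs_le_of_mem_lpBall_top (hy s).2 t))
      _ ≤ α ^ 2 := by
          rw [← Finset.mul_sum]
          exact mul_le_of_le_one_right (sq_nonneg _) (hz s)
  have hform : ∀ (ω : Fin k → Fin d → ZMod 2) s, ∑ i, (∑ t, hadamard d (ω i) t * x s t) ^ 2 =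
      k * (∑ t, x s t ^ 2 - quadDeviation (rowMatrix ω) (x s)) := by
    intro ω s
    simp only [quadDeviation, rowMatrix, Matrix.submatrix_apply, id]
    field_simp
    ring
  -- By `hform`, ‖Φx‖² is k times ‖x‖² minus the deviation, hence at most k(α² + S ω).
  set R : (Fin k → Fin d → ZMod 2) → ℝ := fun ω => √(k * (S ω + α ^ 2)) with hR
  have hRpos : ∀ ω, 0 < R ω := fun ω =>
    Real.sqrt_pos.2 (mul_pos hk0 (add_pos_of_nonneg_of_pos (hS0 ω) (by positivity)))
  have hRx : ∀ (ω : Fin k → Fin d → ZMod 2) s,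
      ∑ i, (∑ t, hadamard d (ω i) t * x s t) ^ 2 ≤ R ω ^ 2 := by
    intro ω s
    rw [hform, hR, Real.sq_sqrt (mul_nonneg hk0.le (add_nonneg (hS0 ω) (sq_nonneg _)))]
    refine mul_le_mul_of_nonneg_left ?_ hk0.le
    have h1 := (abs_quadDeviation_le_specNorm (rowMatrix ω) (y s) (hz s)).trans
      (specNorm_le_supDeviation (rowMatrix ω) (hy s))
    linarith [neg_le_of_abs_le h1, hx2 s]
  have hcard : Fintype.card (Fin d → ZMod 2) = 2 ^ d := by simp [ZMod.card]
  let v : (Fin d → ZMod 2) → (Fin k → Fin d → ZMod 2) → ℝ := fun w s =>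
    (∑ t, hadamard d w t * x s t) ^ 2
  have hcore : ∀ ω : Fin k → Fin d → ZMod 2,
      𝔼 r : Fin k → Bool, ‖∑ i, sgn (r i) • v (ω i)‖ ≤ B * R ω := by
    intro ω
    have h := expect_norm_sum_sgn_sq_le (κ := Fin k) hd hcard hcard (by simpa using hk)
      (fun w t => (abs_hadamard d w t).le) hx1 ω (hRpos ω) (hRx ω)
    rw [Fintype.card_fin] at h
    refine le_of_eq_of_le (Finset.expect_congr rfl fun r _ => ?_) h
    congr 1
    funext s
    simp [v, Finset.sum_apply]
  have hsym := sum_weight_norm_sub_le (κ := Fin k) (fun _ : Fin d → ZMod 2 => 1 / (2 : ℝ) ^ d)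
    (fun _ => by positivity) (by simp [ZMod.card]) v
  have hmean : ∑ w, (1 / (2 : ℝ) ^ d) • v w = fun s => ∑ t, x s t ^ 2 := by
    funext s
    simp only [Finset.sum_apply, Pi.smul_apply, smul_eq_mul, v, ← Finset.mul_sum,
      sum_hadamard_mulVec_sq]
    field_simp
  rw [hmean, ← Finset.mul_sum, ← Finset.mul_sum, Finset.prod_const, Finset.card_univ,
    Fintype.card_fin, mul_left_comm, mul_le_mul_iff_right₀ (by positivity)] at hsym
  have hlow : ∀ ω : Fin k → Fin d → ZMod 2, k * (S ω - δ) ≤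
      ‖∑ i, v (ω i) - (k : ℝ) • fun s => ∑ t, x s t ^ 2‖ := by
    intro ω
    refine le_trans ?_ (norm_le_pi_norm _ ω)
    simp only [Pi.sub_apply, Finset.sum_apply, Pi.smul_apply, smul_eq_mul, v, hform]
    rw [← mul_sub, sub_sub_cancel_left, mul_neg, norm_neg, Real.norm_eq_abs, abs_mul, abs_of_pos hk0]
    exact mul_le_mul_of_nonneg_left (hyz ω) hk0.le
  have hsum : ∑ ω, k * (S ω - δ) ≤ 2 * ∑ ω, B * R ω :=
    (Finset.sum_le_sum fun ω _ => hlow ω).trans (hsym.trans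
      (mul_le_mul_of_nonneg_left (Finset.sum_le_sum fun ω _ => hcore ω) zero_le_two))
  have hexp : k * (expDeviation d k α - δ) ≤ 2 * (B * 𝔼 ω, R ω) := by
    have h1 : (0 : ℝ) < Fintype.card (Fin k → Fin d → ZMod 2) := by
      exact_mod_cast Fintype.card_pos
    have h2 := div_le_div_of_nonneg_right hsum h1.le
    rw [mul_div_assoc, ← Fintype.expect_eq_sum_div_card, ← Fintype.expect_eq_sum_div_card,
      ← Finset.mul_expect, ← Finset.mul_expect, Finset.expect_sub_distrib,
      Fintype.expect_const] at h2
    exact h2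
  have hRE : 𝔼 ω, R ω ≤ √k * √(expDeviation d k α + α ^ 2) := by
    simp only [hR, Real.sqrt_mul hk0.le]
    rw [← Finset.mul_expect]
    refine mul_le_mul_of_nonneg_left ?_ (Real.sqrt_nonneg _)
    have h1 : 𝔼 ω, (S ω + α ^ 2) = expDeviation d k α + α ^ 2 := by
      rw [Finset.expect_add_distrib, Fintype.expect_const]; rfl
    rw [← h1]
    refine expect_sqrt_le _ (fun ω => add_nonneg (hS0 ω) (sq_nonneg _)) ?_
    rw [h1]
    exact add_pos_of_nonneg_of_pos (expDeviation_nonneg d k α) (by positivity)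
  have hfin := hexp.trans (mul_le_mul_of_nonneg_left
    (mul_le_mul_of_nonneg_left hRE hB0) zero_le_two)
  rw [← le_div_iff₀' hk0] at hfin
  rw [← sub_le_iff_le_add]
  refine hfin.trans (le_of_eq ?_)
  have h3 : 0 < √(k : ℝ) := Real.sqrt_pos.2 hk0
  have h4 : √(k : ℝ) * √k = k := Real.mul_self_sqrt hk0.le
  rw [div_mul_eq_mul_div, div_eq_div_iff hk0.ne' h3.ne', hB]
  linear_combination (600 * d * √(Real.log (2 ^ d)) * √(Real.log k) *
    √(expDeviation d k α + α ^ 2)) * h4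

/-! ### Natural logarithms and the self-bounding inequality -/

theorem expDeviation_le_log {d k : ℕ} (hk : 2 ≤ k) {α : ℝ} (hα : 0 < α) :
    expDeviation d k α ≤
      1200 * (Real.log (2 ^ d) ^ (3 / 2 : ℝ) * Real.log k ^ (1 / 2 : ℝ) / √k) *
        √(expDeviation d k α + α ^ 2) := by
  have hk0 : (0 : ℝ) < k := by positivity
  rcases Nat.eq_zero_or_pos d with rfl | hd
  · rw [expDeviation_zero_left (by omega) hα.le]
    have : 0 ≤ Real.log k := Real.log_natCast_nonneg k
    have : 0 ≤ Real.log ((2 : ℝ) ^ 0) := by simp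
    positivity
  have hlog : 0 < Real.log (2 ^ d) :=
    Real.log_pos (one_lt_pow₀ one_lt_two (Nat.pos_iff_ne_zero.1 hd))
  have h32 : Real.log (2 ^ d) ^ (3 / 2 : ℝ) = Real.log (2 ^ d) * √(Real.log (2 ^ d)) := by
    rw [Real.sqrt_eq_rpow, ← Real.rpow_one_add' hlog.le (by norm_num)]
    norm_num
  refine (expDeviation_le hd hk hα).trans ?_
  rw [h32, ← Real.sqrt_eq_rpow]
  refine mul_le_mul_of_nonneg_right ?_ (Real.sqrt_nonneg _)
  rw [← mul_div_assoc]
  refine div_le_div_of_nonneg_right ?_ (Real.sqrt_nonneg _)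
  -- Since 2 log 2 ≥ 1, passing from d to log n doubles 600 to 1200.
  have hd2 : (d : ℝ) ≤ 2 * Real.log (2 ^ d) := by
    rw [Real.log_pow]
    have h1 : (0 : ℝ) ≤ d := by positivity
    have h2 := mul_le_mul_of_nonneg_left
      (by linarith [Real.log_two_gt_d9] : 1 ≤ 2 * Real.log 2) h1
    linarith
  calc 600 * d * √(Real.log (2 ^ d)) * √(Real.log k)
      ≤ 600 * (2 * Real.log (2 ^ d)) * √(Real.log (2 ^ d)) * √(Real.log k) := by gcongr
    _ = _ := by ring

/-- Squaring gives E(E - A²) ≤ A²α²; if E exceeded A² + Aα, both factors on the left would exceed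
Aα. -/
theorem le_of_le_mul_sqrt {E A α : ℝ} (hE : 0 ≤ E) (hA : 0 ≤ A) (hα : 0 ≤ α)
    (h : E ≤ A * √(E + α ^ 2)) : E ≤ A ^ 2 + A * α := by
  by_contra! hlt
  have h1 : E ^ 2 ≤ A ^ 2 * (E + α ^ 2) := by
    have := pow_le_pow_left₀ hE h 2
    rwa [mul_pow, Real.sq_sqrt (by positivity)] at this
  have hAα : 0 ≤ A * α := mul_nonneg hA hα
  have h2 : A * α < E - A ^ 2 := by linarith
  have h3 : A * α < E := by linarith [sq_nonneg A]
  have h4 : (A * α) * (A * α) < E * (E - A ^ 2) := mul_lt_mul'' h3 h2 hAα hAα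
  linarith

end RandomHadamard

theorem theorem1 :
    (∃ C₁ : ℝ, 0 < C₁ ∧
      ∀ (n d k : ℕ) (α : ℝ), n = 2 ^ d → 2 ≤ k → 0 < α →
        RandomHadamard.expDeviation d k α ≤
          C₁ * Real.log n ^ (3 / 2 : ℝ) * Real.log k ^ (1 / 2 : ℝ) / Real.sqrt k *
            (RandomHadamard.expDeviation d k α + α ^ 2) ^ (1 / 2 : ℝ)) ∧
    (∀ K : ℝ, 0 < K → ∃ C : ℝ, 0 < C ∧
      ∀ (n d k : ℕ) (α : ℝ), n = 2 ^ d → 2 ≤ k → 0 < α →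
        Real.log n ^ (3 / 2 : ℝ) * Real.log k ^ (1 / 2 : ℝ) / Real.sqrt k ≤ K * α →
        RandomHadamard.expDeviation d k α ≤
          C * (α * Real.log n ^ (3 / 2 : ℝ) * Real.log k ^ (1 / 2 : ℝ) / Real.sqrt k)) := by
  constructor
  · refine ⟨1200, by norm_num, ?_⟩
    rintro n d k α rfl hk hα
    rw [← Real.sqrt_eq_rpow (_ + _)]
    refine (RandomHadamard.expDeviation_le_log hk hα).trans (le_of_eq ?_)
    push_cast
    ring
  · intro K hK
    -- With A = 1200 L and L ≤ Kα, A² + Aα ≤ (1200² K + 1200) α L.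
    refine ⟨1200 ^ 2 * K + 1200, by positivity, ?_⟩
    rintro n d k α rfl hk hα hle
    have h := RandomHadamard.expDeviation_le_log (d := d) hk hα
    push_cast at hle ⊢
    have hL0 : 0 ≤ Real.log (2 ^ d) ^ (3 / 2 : ℝ) * Real.log k ^ (1 / 2 : ℝ) / √k := by
      have : 0 ≤ Real.log k := Real.log_natCast_nonneg k
      have : 0 ≤ Real.log ((2 : ℝ) ^ d) := Real.log_nonneg (one_le_pow₀ one_le_two)
      positivity
    rw [show α * Real.log (2 ^ d) ^ (3 / 2 : ℝ) * Real.log k ^ (1 / 2 : ℝ) / √k =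
      α * (Real.log (2 ^ d) ^ (3 / 2 : ℝ) * Real.log k ^ (1 / 2 : ℝ) / √k) by ring]
    generalize Real.log (2 ^ d) ^ (3 / 2 : ℝ) * Real.log k ^ (1 / 2 : ℝ) / √k = L at *
    have h1 := RandomHadamard.le_of_le_mul_sqrt (RandomHadamard.expDeviation_nonneg d k α)
      (by positivity) hα.le h
    have h2 := mul_le_mul_of_nonneg_left hle hL0
    linarith
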